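/- Let $G=(V,E)$ be a finite, connected, undirected, unweighted simple graph, and let $b\in\mathbb{R}^V$ satisfy $\mathbf{1}^{T}b=\sum_{u\in V}b(u)=0$. A \emph{flow with demand $b$} on a graph $H$ with vertex set $V$ assigns to each edge of $H$ a signed amount of flow, i.e. it is a function $f:V\times V\to\mathbb{R}$ with $f(y,x)=-f(x,y)$ for all $x,y$, with $f(x,y)=0$ whenever $xy$ is not an edge of $H$, and with $\sum_{w\in V}f(w,u)=b(u)$ for every $u\in V$ (so $b(u)$ is the amount of flow that comes out of the network through $u$). An \emph{electrical flow} with demand $b$ on $G$ (every edge being a unit resistor) is a flow $f$ with demand $b$ on $G$ for which there are voltages $x\in\mathbb{R}^V$ with $f(u,w)=x(u)-x(w)$ for every edge $uw$ of $G$. Let $\mathcal{T}$ be the set of spanning trees of $G$. Then there is exactly one electrical flow $f$ with demand $b$ on $G$; the set $\mathcal{T}$ is non-empty; for every $T\in\mathcal{T}$ there is exactly one flow $f_T$ with demand $b$ on $T$; and $$f=\sum_{T\in\mathcal{T}}\frac{1}{|\mathcal{T}|}\,f_T .$$ -/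

import Mathlib

namespace SimpleGraph

/-- The spanning trees of `G`: the trees on the whole vertex set all of whose edges are
edges of `G`. -/
noncomputable def spanningTrees {V : Type*} [Finite V] (G : SimpleGraph V) :
    Finset (SimpleGraph V) :=
  (Set.toFinite {T : SimpleGraph V | T ≤ G ∧ T.IsTree}).toFinset

theorem mem_spanningTrees {V : Type*} [Finite V] {G T : SimpleGraph V} :
    T ∈ G.spanningTrees ↔ T ≤ G ∧ T.IsTree := by
  simp [spanningTrees]

/-- `f` is a flow on the edges of `G` with demand `b`. Here `f x y` is the signed amount of flow
along the edge `xy` in the direction from `x` to `y`, and `b u` is the amount of flow that leaves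
the network through the vertex `u` (a negative amount means that flow enters at `u`). -/
structure IsFlow {V : Type*} [Fintype V] (G : SimpleGraph V) (b : V → ℝ) (f : V → V → ℝ) :
    Prop where
  antisymm : ∀ x y, f y x = -f x y
  support : ∀ x y, ¬ G.Adj x y → f x y = 0
  /-- Kirchhoff's current law: the net flow that arrives at `u` is the demand at `u`. -/
  demand : ∀ u, ∑ w, f w u = b u

/-- `f` is an electrical flow with demand `b` in the network in which every edge of `G` is a unit
resistor: a flow with demand `b` that satisfies Ohm's law for some voltages `x` at the
vertices. -/
structure IsElectricalFlow {V : Type*} [Fintype V] (G : SimpleGraph V) (b : V → ℝ)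
    (f : V → V → ℝ) : Prop extends IsFlow G b f where
  ohm : ∃ x : V → ℝ, ∀ u w, G.Adj u w → f u w = x u - x w

end SimpleGraph

/-! An electrical flow is unique (`IsElectricalFlow.unique`) and the average of the tree flows has
demand `b`, so only Ohm's law for the average is at stake. In a tree `T` containing `xy`, the flow
from `x` to `y` is the total demand on the `y` side of `T - xy` (`IsFlow.eq_componentDemand`).
Deleting `xy` turns these trees into the two-component forests `F` separating `x` from `y`
(`sum_spanningTrees_deleteEdges`). Write `D_F(u)` for the demand in the component of `u`. As `D_F(x)
+ D_F(y) = 0`, each such `F` contributes `(D_F(y) - D_F(x)) / 2`, which is zero for every other `F`.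
Summing over all two-component forests gives a difference of voltages `-∑ D_F(u) / 2`, whose
definition does not involve the edge. -/

namespace SimpleGraph

/-! ### Flows: existence, energy uniqueness, and flow across a bridge -/

section Flows

variable {V : Type*} [Fintype V] {G H : SimpleGraph V} {b c : V → ℝ} {f g : V → V → ℝ}

theorem IsFlow.mono (hf : H.IsFlow b f) (h : H ≤ G) : G.IsFlow b f :=
  ⟨hf.antisymm, fun x y hxy => hf.support x y fun h' => hxy (h h'), hf.demand⟩

theorem IsFlow.zero : G.IsFlow (0 : V → ℝ) 0 := ⟨by simp, by simp, by simp⟩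

theorem IsFlow.add (hf : G.IsFlow b f) (hg : G.IsFlow c g) : G.IsFlow (b + c) (f + g) where
  antisymm x y := by simp only [Pi.add_apply, hf.antisymm x y, hg.antisymm x y]; ring
  support x y h := by simp [hf.support x y h, hg.support x y h]
  demand u := by simp [Finset.sum_add_distrib, hf.demand, hg.demand]

theorem IsFlow.smul (hf : G.IsFlow b f) (r : ℝ) : G.IsFlow (r • b) (r • f) where
  antisymm x y := by simp [hf.antisymm x y]
  support x y h := by simp [hf.support x y h]
  demand u := by simp [← Finset.mul_sum, hf.demand]

theorem IsFlow.sub (hf : G.IsFlow b f) (hg : G.IsFlow c g) : G.IsFlow (b - c) (f - g) := by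
  simpa [sub_eq_add_neg] using hf.add (hg.smul (-1))

theorem IsFlow.sum {ι : Type*} (s : Finset ι) {b : ι → V → ℝ} {f : ι → V → V → ℝ}
    (h : ∀ i ∈ s, G.IsFlow (b i) (f i)) : G.IsFlow (∑ i ∈ s, b i) (∑ i ∈ s, f i) := by
  classical
  induction s using Finset.induction_on with
  | empty => simpa using IsFlow.zero
  | insert i s hi ih =>
    rw [Finset.sum_insert hi, Finset.sum_insert hi]
    exact (h i (Finset.mem_insert_self i s)).add
      (ih fun j hj => h j (Finset.mem_insert_of_mem hj))

/-- A unit of flow along a single edge. -/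
theorem Adj.exists_isFlow [DecidableEq V] {u v : V} (h : G.Adj u v) :
    ∃ f, G.IsFlow (Pi.single v 1 - Pi.single u 1) f := by
  refine ⟨fun x y => (if x = u ∧ y = v then 1 else 0) - (if x = v ∧ y = u then 1 else 0),
    fun x y => ?_, fun x y hxy => ?_, fun w => ?_⟩
  · simp only [and_comm (a := y = _)]; ring
  · have h1 : ¬ (x = u ∧ y = v) := by rintro ⟨rfl, rfl⟩; exact hxy h
    have h2 : ¬ (x = v ∧ y = u) := by rintro ⟨rfl, rfl⟩; exact hxy h.symm
    simp [h1, h2]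
  · simp [Finset.sum_sub_distrib, ite_and, Pi.single_apply]

theorem Reachable.exists_isFlow [DecidableEq V] {u v : V} (h : G.Reachable u v) :
    ∃ f, G.IsFlow (Pi.single v 1 - Pi.single u 1) f := by
  obtain ⟨p⟩ := h
  induction p with
  | nil => exact ⟨0, by simpa using IsFlow.zero⟩
  | cons h p ih =>
    obtain ⟨f, hf⟩ := ih
    obtain ⟨g, hg⟩ := h.exists_isFlow
    exact ⟨f + g, by simpa using hf.add hg⟩

theorem Connected.exists_isFlow (hG : G.Connected) (hb : ∑ u, b u = 0) :
    ∃ f, G.IsFlow b f := by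
  classical
  obtain ⟨r⟩ := hG.nonempty
  choose f hf using fun v => (hG.preconnected r v).exists_isFlow
  have h := IsFlow.sum Finset.univ fun v _ => (hf v).smul (b v)
  refine ⟨∑ v, b v • f v, ?_⟩
  convert! h using 1
  ext u
  -- Sending `b v` from `r` to each `v` leaves an excess `-∑ b` at `r`, which vanishes.
  simp only [Finset.sum_apply, Pi.smul_apply, Pi.sub_apply, Pi.single_apply, smul_eq_mul,
    mul_sub, Finset.sum_sub_distrib, ← Finset.sum_mul, hb]
  simp

/-- Two flows with the same demand that both satisfy Ohm's law agree, since their difference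
dissipates no energy. -/
theorem IsElectricalFlow.unique (hf : G.IsElectricalFlow b f) (hg : G.IsElectricalFlow b g) :
    f = g := by
  obtain ⟨x, hx⟩ := hf.ohm
  obtain ⟨y, hy⟩ := hg.ohm
  have hd := hf.toIsFlow.sub hg.toIsFlow
  rw [sub_self] at hd
  set d := f - g
  set z := x - y
  -- Summed over all pairs, the right side vanishes by Kirchhoff's law with zero demand, leaving
  -- zero energy.
  have hz : ∀ u w, d u w * d u w = z u * d u w - z w * d u w := by
    intro u w
    by_cases h : G.Adj u w
    · have : d u w = z u - z w := by
        simp only [d, z, Pi.sub_apply, hx u w h, hy u w h]; ring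
      rw [← sub_mul, ← this]
    · simp [hd.support u w h]
  have h1 : ∑ u, ∑ w, z w * d u w = 0 := by
    rw [Finset.sum_comm]
    simp [← Finset.mul_sum, hd.demand]
  have h2 : ∑ u, ∑ w, z u * d u w = 0 := by
    have : ∀ u, ∑ w, d u w = 0 := fun u => by
      rw [Finset.sum_congr rfl fun w _ => hd.antisymm w u, Finset.sum_neg_distrib, hd.demand]
      simp
    simp [← Finset.mul_sum, this]
  have h3 : ∑ u, ∑ w, d u w * d u w = 0 := by
    simp only [hz, Finset.sum_sub_distrib, h1, h2, sub_zero]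
  have hd0 : d = 0 := by
    ext u w
    have hu := (Finset.sum_eq_zero_iff_of_nonneg fun u _ =>
      Finset.sum_nonneg fun w _ => mul_self_nonneg (d u w)).1 h3 u (Finset.mem_univ u)
    exact mul_self_eq_zero.1 ((Finset.sum_eq_zero_iff_of_nonneg fun w _ =>
      mul_self_nonneg (d u w)).1 hu w (Finset.mem_univ w))
  exact sub_eq_zero.1 hd0

open Classical in
/-- The total demand in the connected component of `u`. -/
noncomputable def componentDemand (G : SimpleGraph V) (b : V → ℝ) (u : V) : ℝ :=
  ∑ v, if G.Reachable v u then b v else 0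

theorem componentDemand_congr {u v : V} (h : G.Reachable u v) :
    G.componentDemand b u = G.componentDemand b v := by
  have : ∀ w, G.Reachable w u ↔ G.Reachable w v :=
    fun w => ⟨fun h' => h'.trans h, fun h' => h'.trans h.symm⟩
  unfold componentDemand
  congr! 2 with w
  exact this w

theorem componentDemand_add {x y : V} (hxy : ¬ G.Reachable x y)
    (h : ∀ v, G.Reachable v x ∨ G.Reachable v y) :
    G.componentDemand b x + G.componentDemand b y = ∑ v, b v := by
  rw [componentDemand, componentDemand, ← Finset.sum_add_distrib]
  refine Finset.sum_congr rfl fun v _ => ?_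
  by_cases hx : G.Reachable v x
  · have hy : ¬ G.Reachable v y := fun hy => hxy (hx.symm.trans hy)
    simp [hx, hy]
  · simp [hx, (h v).resolve_left hx]

/-- The flow across a bridge is the total demand behind it. -/
theorem IsFlow.eq_componentDemand (hf : G.IsFlow b f) {x y : V} (hxy : G.Adj x y)
    (hbr : G.IsBridge s(x, y)) :
    f x y = (G.deleteEdges {s(x, y)}).componentDemand b y := by
  classical
  set P : V → Prop := fun v => (G.deleteEdges {s(x, y)}).Reachable v y
  have hPx : ¬ P x := isBridge_iff.1 hbr
  have hPy : P y := Reachable.refl y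
  -- Flow inside the side of `y` cancels in opposite pairs.
  have hin : ∑ v, ∑ w, (if P v ∧ P w then f w v else 0) = 0 := by
    have h : ∑ v, ∑ w, (if P v ∧ P w then f w v else 0)
        = - ∑ v, ∑ w, (if P v ∧ P w then f w v else 0) := by
      conv_lhs => rw [Finset.sum_comm]
      simp only [← Finset.sum_neg_distrib]
      refine Finset.sum_congr rfl fun v _ => Finset.sum_congr rfl fun w _ => ?_
      simp only [and_comm (a := P w), hf.antisymm w v]
      split_ifs <;> simp
    linarith
  -- Only the bridge itself enters that side from outside.
  have hout : ∀ v w, (if P v ∧ ¬ P w then f w v else 0)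
      = if v = y ∧ w = x then f x y else 0 := by
    intro v w
    by_cases h : v = y ∧ w = x
    · obtain ⟨rfl, rfl⟩ := h
      simp [hPx, hPy]
    · rw [if_neg h]
      split_ifs with h'
      · refine hf.support w v fun hwv => ?_
        by_cases he : s(w, v) = s(x, y)
        · rcases Sym2.eq_iff.1 he with ⟨rfl, rfl⟩ | ⟨rfl, rfl⟩
          · exact h ⟨rfl, rfl⟩
          · exact hPx h'.1
        · refine h'.2 (Reachable.trans (Adj.reachable ?_) h'.1)
          rw [deleteEdges_adj]
          exact ⟨hwv, he⟩
      · rfl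
  have hsplit : ∀ v, (if P v then b v else 0)
      = ∑ w, (if P v ∧ P w then f w v else 0) + ∑ w, (if P v ∧ ¬ P w then f w v else 0) := by
    intro v
    rw [← Finset.sum_add_distrib, ← hf.demand v]
    by_cases hv : P v
    · rw [if_pos hv]
      refine Finset.sum_congr rfl fun w _ => ?_
      by_cases hw : P w <;> simp [hv, hw]
    · simp [hv]
  have key : ∑ v, (if P v then b v else 0) = f x y := by
    simp only [hsplit, Finset.sum_add_distrib, hin, hout]
    simp [ite_and]
  rw [← key, componentDemand]
  congr!

theorem IsAcyclic.isFlow_unique (hG : G.IsAcyclic) (hf : G.IsFlow b f) (hg : G.IsFlow b g) :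
    f = g := by
  ext x y
  by_cases h : G.Adj x y
  · have hbr := isAcyclic_iff_forall_isBridge.1 hG (G.mem_edgeSet.2 h)
    rw [hf.eq_componentDemand h hbr, hg.eq_componentDemand h hbr]
  · rw [hf.support x y h, hg.support x y h]

end Flows

/-! ### Spanning trees and two-component forests -/

section TwoForests

variable {V : Type*} {G F T : SimpleGraph V}

/-- Stop a walk to `x` just before it first uses `xy`: it is then at `x` or `y`. -/
theorem Reachable.deleteEdges_or {v x : V} (h : G.Reachable v x) (y : V) :
    (G.deleteEdges {s(x, y)}).Reachable v x ∨ (G.deleteEdges {s(x, y)}).Reachable v y := by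
  obtain ⟨p⟩ := h
  induction p with
  | nil => exact .inl (Reachable.refl _)
  | @cons u w x h p ih =>
    by_cases he : s(u, w) = s(x, y)
    · rcases Sym2.eq_iff.1 he with ⟨rfl, -⟩ | ⟨rfl, -⟩
      · exact .inl (Reachable.refl _)
      · exact .inr (Reachable.refl _)
    · have hadj : (G.deleteEdges {s(x, y)}).Adj u w := by
        rw [deleteEdges_adj]
        exact ⟨h, he⟩
      exact ih.imp hadj.reachable.trans hadj.reachable.trans

/-- An acyclic graph with exactly two connected components. -/
def IsTwoForest (F : SimpleGraph V) : Prop :=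
  F.IsAcyclic ∧ ∃ x y, ¬ F.Reachable x y ∧ ∀ v, F.Reachable v x ∨ F.Reachable v y

theorem IsTwoForest.reachable_or (hF : F.IsTwoForest) {x y : V} (hxy : ¬ F.Reachable x y)
    (v : V) : F.Reachable v x ∨ F.Reachable v y := by
  obtain ⟨-, p, q, -, h⟩ := hF
  rcases h v with hv | hv <;> rcases h x with hx | hx <;> rcases h y with hy | hy <;>
    first
    | exact absurd (hx.trans hy.symm) hxy
    | exact .inl (hv.trans hx.symm)
    | exact .inr (hv.trans hy.symm)

theorem IsTree.isTwoForest_deleteEdges (hT : T.IsTree) {x y : V} (hxy : T.Adj x y) :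
    (T.deleteEdges {s(x, y)}).IsTwoForest :=
  ⟨hT.isAcyclic.anti (deleteEdges_le _), x, y,
    isBridge_iff.1 (isAcyclic_iff_forall_isBridge.1 hT.isAcyclic (T.mem_edgeSet.2 hxy)),
    fun v => (hT.connected.preconnected v x).deleteEdges_or y⟩

theorem IsTwoForest.isTree_sup_edge (hF : F.IsTwoForest) {x y : V} (hxy : ¬ F.Reachable x y) :
    (F ⊔ edge x y).IsTree := by
  have hne : x ≠ y := by rintro rfl; exact hxy (Reachable.refl _)
  have hadj : (F ⊔ edge x y).Adj y x := by
    rw [sup_adj, edge_adj]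
    exact .inr ⟨.inr ⟨rfl, rfl⟩, hne.symm⟩
  have : Nonempty V := ⟨x⟩
  have h : ∀ v, (F ⊔ edge x y).Reachable v x := fun v =>
    (hF.reachable_or hxy v).elim (fun h => h.mono le_sup_left)
      fun h => (h.mono le_sup_left).trans hadj.reachable
  exact ⟨⟨fun u v => (h u).trans (h v).symm⟩, hF.1.sup_edge_of_not_reachable hxy⟩

theorem deleteEdges_sup_edge {x y : V} (hxy : G.Adj x y) :
    G.deleteEdges {s(x, y)} ⊔ edge x y = G := by
  ext u v
  simp only [sup_adj, deleteEdges_adj, Set.mem_singleton_iff, adj_edge]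
  constructor
  · rintro (h | ⟨h, -⟩)
    · exact h.1
    · exact (G.adj_congr_of_sym2 h).1 hxy
  · intro h
    by_cases he : s(u, v) = s(x, y)
    · exact .inr ⟨he.symm, h.ne⟩
    · exact .inl ⟨h, he⟩

theorem sup_edge_deleteEdges {x y : V} (hxy : ¬ G.Adj x y) :
    (G ⊔ edge x y).deleteEdges {s(x, y)} = G := by
  ext u v
  simp only [sup_adj, deleteEdges_adj, Set.mem_singleton_iff, adj_edge]
  constructor
  · rintro ⟨h | h, he⟩
    · exact h
    · exact absurd h.1.symm he
  · exact fun h => ⟨.inl h, fun he => hxy ((G.adj_congr_of_sym2 he).1 h)⟩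

variable [Fintype V]

open Classical in
/-- The spanning forests of `G` with exactly two connected components. -/
noncomputable def spanningTwoForests (G : SimpleGraph V) : Finset (SimpleGraph V) :=
  {F | F ≤ G ∧ F.IsTwoForest}

theorem mem_spanningTwoForests : F ∈ G.spanningTwoForests ↔ F ≤ G ∧ F.IsTwoForest := by
  simp [spanningTwoForests]

open Classical in
/-- Deleting the edge `xy` is a bijection from the spanning trees that contain `xy` to the
spanning two-component forests that separate `x` from `y`. -/
theorem sum_spanningTrees_deleteEdges {M : Type*} [AddCommMonoid M] {x y : V} (hxy : G.Adj x y)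
    (φ : SimpleGraph V → M) :
    ∑ T ∈ G.spanningTrees with T.Adj x y, φ (T.deleteEdges {s(x, y)})
      = ∑ F ∈ G.spanningTwoForests with ¬ F.Reachable x y, φ F := by
  refine Finset.sum_bij' (fun T _ => T.deleteEdges {s(x, y)}) (fun F _ => F ⊔ edge x y)
    ?_ ?_ ?_ ?_ ?_
  · intro T hT
    rw [Finset.mem_filter, mem_spanningTrees] at hT
    rw [Finset.mem_filter, mem_spanningTwoForests]
    exact ⟨⟨(deleteEdges_le _).trans hT.1.1, hT.1.2.isTwoForest_deleteEdges hT.2⟩,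
      isBridge_iff.1 (isAcyclic_iff_forall_isBridge.1 hT.1.2.isAcyclic (T.mem_edgeSet.2 hT.2))⟩
  · intro F hF
    rw [Finset.mem_filter, mem_spanningTwoForests] at hF
    rw [Finset.mem_filter, mem_spanningTrees]
    refine ⟨⟨sup_le hF.1.1 ((edge_le_iff G).2 (.inr hxy)), hF.1.2.isTree_sup_edge hF.2⟩, ?_⟩
    rw [sup_adj, edge_adj]
    exact .inr ⟨.inl ⟨rfl, rfl⟩, hxy.ne⟩
  · intro T hT
    exact deleteEdges_sup_edge (Finset.mem_filter.1 hT).2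
  · intro F hF
    exact sup_edge_deleteEdges fun h => (Finset.mem_filter.1 hF).2 h.reachable
  · exact fun _ _ => rfl

/-- The sum of the flows on the spanning trees satisfies Ohm's law. -/
theorem sum_isFlow_spanningTrees {b : V → ℝ} (hb : ∑ u, b u = 0)
    {f : SimpleGraph V → V → V → ℝ} (hf : ∀ T ∈ G.spanningTrees, T.IsFlow b (f T))
    {x y : V} (hxy : G.Adj x y) :
    ∑ T ∈ G.spanningTrees, f T x y
      = (∑ F ∈ G.spanningTwoForests, F.componentDemand b y) / 2
        - (∑ F ∈ G.spanningTwoForests, F.componentDemand b x) / 2 := by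
  classical
  have h1 : ∑ T ∈ G.spanningTrees, f T x y
      = ∑ T ∈ G.spanningTrees with T.Adj x y,
          (T.deleteEdges {s(x, y)}).componentDemand b y := by
    rw [Finset.sum_filter]
    refine Finset.sum_congr rfl fun T hT => ?_
    split_ifs with h
    · exact (hf T hT).eq_componentDemand h (isAcyclic_iff_forall_isBridge.1
        (mem_spanningTrees.1 hT).2.isAcyclic (T.mem_edgeSet.2 h))
    · exact (hf T hT).support x y h
  rw [h1, sum_spanningTrees_deleteEdges hxy fun F => F.componentDemand b y, ← sub_div,
    ← Finset.sum_sub_distrib, Finset.sum_div, Finset.sum_filter]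
  refine Finset.sum_congr rfl fun F hF => ?_
  -- A forest joining `x` to `y` contributes zero; in a separating one the two demands are opposite,
  -- whence the factor 1/2.
  split_ifs with h
  · rw [componentDemand_congr h, sub_self, zero_div]
  · have := componentDemand_add (b := b) h ((mem_spanningTwoForests.1 hF).2.reachable_or h)
    rw [hb] at this
    linarith

theorem Connected.spanningTrees_nonempty (hG : G.Connected) : G.spanningTrees.Nonempty := by
  obtain ⟨T, hT⟩ := hG.exists_isTree_le
  exact ⟨T, mem_spanningTrees.2 hT⟩

theorem Connected.isElectricalFlow_average (hG : G.Connected) {b : V → ℝ}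
    (hb : ∑ u, b u = 0) {f : SimpleGraph V → V → V → ℝ}
    (hf : ∀ T ∈ G.spanningTrees, T.IsFlow b (f T)) :
    G.IsElectricalFlow b (∑ T ∈ G.spanningTrees, (1 / (G.spanningTrees.card : ℝ)) • f T) where
  toIsFlow := by
    have h := IsFlow.sum G.spanningTrees fun T hT =>
      ((hf T hT).mono (mem_spanningTrees.1 hT).1).smul (1 / (G.spanningTrees.card : ℝ))
    have hcard : (G.spanningTrees.card : ℝ) ≠ 0 :=
      Nat.cast_ne_zero.2 (Finset.card_ne_zero.2 hG.spanningTrees_nonempty)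
    rwa [Finset.sum_const, ← Nat.cast_smul_eq_nsmul ℝ, smul_smul, mul_one_div_cancel hcard,
      one_smul] at h
  ohm := by
    refine ⟨fun u => 1 / (G.spanningTrees.card : ℝ) *
      ((∑ F ∈ G.spanningTwoForests, -F.componentDemand b u) / 2), fun x y hxy => ?_⟩
    rw [← Finset.smul_sum]
    simp only [Pi.smul_apply, Finset.sum_apply, smul_eq_mul, sum_isFlow_spanningTrees hb hf hxy,
      Finset.sum_neg_distrib]
    ring

end TwoForests

end SimpleGraph

theorem mainTheorem4 {V : Type*} [Fintype V] (G : SimpleGraph V) (hG : G.Connected)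
    (b : V → ℝ) (hb : ∑ u, b u = 0) :
    (∃! f : V → V → ℝ, G.IsElectricalFlow b f) ∧
    G.spanningTrees.Nonempty ∧
    (∀ T ∈ G.spanningTrees, ∃! g : V → V → ℝ, T.IsFlow b g) ∧
    ∀ (f : V → V → ℝ) (fT : SimpleGraph V → V → V → ℝ),
      G.IsElectricalFlow b f →
      (∀ T ∈ G.spanningTrees, T.IsFlow b (fT T)) →
      f = ∑ T ∈ G.spanningTrees, (1 / (G.spanningTrees.card : ℝ)) • fT T := by
  have htree : ∀ T ∈ G.spanningTrees, ∃! g : V → V → ℝ, T.IsFlow b g := fun T hT => by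
    have hT' := (SimpleGraph.mem_spanningTrees.1 hT).2
    obtain ⟨g, hg⟩ := hT'.connected.exists_isFlow hb
    exact ⟨g, hg, fun g' hg' => hT'.isAcyclic.isFlow_unique hg' hg⟩
  refine ⟨?_, hG.spanningTrees_nonempty, htree, fun f fT hf hfT =>
    hf.unique (hG.isElectricalFlow_average hb hfT)⟩
  -- The average of the tree flows also supplies the existence of an electrical flow.
  choose! fT hfT _ using htree
  exact ⟨_, hG.isElectricalFlow_average hb hfT,
    fun f hf => hf.unique (hG.isElectricalFlow_average hb hfT)⟩
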